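/- Let $\lambda\colon[0,\infty)\to(0,\infty)$ be continuous with $\frac1\lambda\notin L^1(0,\infty)$. Let $L^2_\lambda(0,\infty)$ be the Hilbert space of (classes of) measurable functions $x\colon(0,\infty)\to\mathbb{C}$ with $\|x\|^2=\int_0^\infty\lambda(\xi)|x(\xi)|^2\,d\xi<\infty$. Put $p_\lambda(\xi)=\int_0^\xi\lambda(\zeta)^{-1}\,d\zeta$ for $\xi\geqslant0$. Then $p_\lambda\colon[0,\infty)\to[0,\infty)$ is bijective, so that $\mu_\lambda(\xi,t):=p_\lambda^{-1}(p_\lambda(\xi)+t)-\xi$ is well defined for $\xi,t\geqslant0$. Moreover, the operator $A_\lambda\colon D(A_\lambda)\subseteq L^2_\lambda(0,\infty)\to L^2_\lambda(0,\infty)$, $$A_\lambda x=(\lambda x)',\qquad D(A_\lambda)=\bigl\{x\in L^2_\lambda(0,\infty)\;:\;\lambda x\in \mathrm{AC}_{\mathrm{loc}}[0,\infty)\text{ and }(\lambda x)'\in L^2_\lambda(0,\infty)\bigr\}$$ (no boundary condition at $0$), generates the $C_0$-semigroup $(T_\lambda(t))_{t\geqslant0}$ of bounded operators on $L^2_\lambda(0,\infty)$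 given, for $x\in L^2_\lambda(0,\infty)$, $t\geqslant0$ and almost every $\xi>0$, by $$(T_\lambda(t)x)(\xi)=\frac{\lambda(\xi+\mu_\lambda(\xi,t))}{\lambda(\xi)}\,x(\xi+\mu_\lambda(\xi,t)).$$ Here $\lambda x\in\mathrm{AC}_{\mathrm{loc}}[0,\infty)$ means that $\lambda x$ agrees almost everywhere with a function that is absolutely continuous on every compact interval $[a,b]\subseteq[0,\infty)$, and $(\lambda x)'$ is its almost everywhere defined derivative. -/

import Mathlib

open MeasureTheory Set Filter Topology
open scoped NNReal ENNReal

namespace WeightedTransport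

noncomputable section

/-! ## Strongly continuous semigroups and their generators -/

section Semigroup

variable {X : Type*} [NormedAddCommGroup X] [NormedSpace ℂ X]

/-- `(T(t))_{t ≥ 0}` is a `C₀`-semigroup of bounded operators on `X`: it satisfies `T(0) = 1` and
`T(s + t) = T(s) T(t)`, and all orbits `t ↦ T(t) x` are norm continuous on `[0, ∞)`. -/
structure IsC0Semigroup (T : ℝ≥0 → X →L[ℂ] X) : Prop where
  map_zero : T 0 = ContinuousLinearMap.id ℂ X
  map_add : ∀ s t : ℝ≥0, T (s + t) = (T s).comp (T t)
  continuous_orbit : ∀ x : X, Continuous fun t : ℝ≥0 => T t x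

/-- The unbounded operator `A` is the infinitesimal generator of `(T(t))_{t ≥ 0}`: for all `x` and
`z`, one has `x ∈ D(A)` and `A x = z` if and only if `(T(t) x - x) / t → z` in norm as `t ↘ 0`.
In particular `D(A)` consists of exactly those `x` for which this limit exists. -/
def IsGeneratorOf (A : X →ₗ.[ℂ] X) (T : ℝ≥0 → X →L[ℂ] X) : Prop :=
  ∀ x z : X, (x, z) ∈ A.graph ↔
    Tendsto (fun t : ℝ≥0 => ((t : ℝ)⁻¹ : ℂ) • (T t x - x)) (𝓝[>] 0) (𝓝 z)

end Semigroup

/-! ## The weighted space and the weighted transport operator -/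

/-- Lebesgue measure on the open half-line `(0, ∞)`. -/
abbrev halfLine : Measure ℝ := volume.restrict (Ioi 0)

/-- The measure `lam(ξ) dξ` on `(0, ∞)`. -/
def weighted (lam : ℝ → ℝ) : Measure ℝ := halfLine.withDensity fun ξ => ENNReal.ofReal (lam ξ)

/-- The weighted space `L²_lam(0, ∞)` of (classes of) complex valued functions `x` such that
`∫_0^∞ lam(ξ) |x(ξ)|² dξ < ∞`. -/
abbrev L2 (lam : ℝ → ℝ) : Type := Lp ℂ 2 (weighted lam)

/-- `y` is locally absolutely continuous on `I`: it is absolutely continuous on every compact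
interval `[a, b] ⊆ I`. -/
def LocallyAC (y : ℝ → ℂ) (I : Set ℝ) : Prop :=
  ∀ a b : ℝ, a ≤ b → Icc a b ⊆ I → AbsolutelyContinuousOnInterval y a b

/-- `y` is a locally absolutely continuous function on `[0, ∞)` that represents `lam x` and whose
almost everywhere defined derivative belongs to `L²_lam(0, ∞)`. -/
structure IsACRep (lam : ℝ → ℝ) (x : L2 lam) (y : ℝ → ℂ) : Prop where
  locallyAC : LocallyAC y (Ici 0)
  ae_eq : ∀ᵐ ξ ∂halfLine, y ξ = (lam ξ : ℂ) * x ξ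
  memLp_deriv : MemLp (deriv y) 2 (weighted lam)

variable {lam : ℝ → ℝ}

theorem weighted_ac : weighted lam ≪ halfLine :=
  withDensity_absolutelyContinuous _ _

theorem ac_weighted (hc : ContinuousOn lam (Ici 0)) (hpos : ∀ ξ, 0 ≤ ξ → 0 < lam ξ) :
    halfLine ≪ weighted lam := by
  refine withDensity_absolutelyContinuous' ?_ ?_
  · exact ((hc.mono Ioi_subset_Ici_self).aemeasurable measurableSet_Ioi).ennreal_ofReal
  · filter_upwards [ae_restrict_mem measurableSet_Ioi] with ξ hξ
    exact (ENNReal.ofReal_pos.2 (hpos ξ (le_of_lt hξ))).ne'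

theorem LocallyAC.continuousOn {y : ℝ → ℂ} (h : LocallyAC y (Ici 0)) :
    ContinuousOn y (Ioi 0) := by
  intro ξ hξ
  have h0 : (0 : ℝ) < ξ := hξ
  have h1 := (h 0 (ξ + 1) (by linarith) Icc_subset_Ici_self).continuousOn
  rw [uIcc_of_le (by linarith)] at h1
  exact (h1.continuousAt (Icc_mem_nhds h0 (by linarith))).continuousWithinAt

theorem LocallyAC.ae_differentiableAt {y : ℝ → ℂ} (h : LocallyAC y (Ici 0)) :
    ∀ᵐ ξ ∂halfLine, DifferentiableAt ℝ y ξ := by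
  have h1 : ∀ n : ℕ, ∀ᵐ ξ : ℝ, ξ ∈ uIcc (0 : ℝ) n → DifferentiableAt ℝ y ξ := fun n =>
    (h 0 n n.cast_nonneg Icc_subset_Ici_self).boundedVariationOn.ae_differentiableAt_of_mem_uIcc
  rw [ae_restrict_iff' measurableSet_Ioi]
  filter_upwards [ae_all_iff.2 h1] with ξ hξ h0
  obtain ⟨n, hn⟩ := exists_nat_ge ξ
  exact hξ n (by rw [uIcc_of_le n.cast_nonneg]; exact ⟨le_of_lt h0, hn⟩)

/-- The class of the derivative does not depend on the chosen representative of `lam x`. -/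
theorem IsACRep.deriv_ae_eq {x : L2 lam} {y z : ℝ → ℂ} (hy : IsACRep lam x y)
    (hz : IsACRep lam x z) : ∀ᵐ ξ ∂halfLine, deriv y ξ = deriv z ξ := by
  have h : EqOn y z (Ioi 0) := by
    refine Measure.eqOn_open_of_ae_eq (μ := volume) ?_ isOpen_Ioi hy.locallyAC.continuousOn
      hz.locallyAC.continuousOn
    filter_upwards [hy.ae_eq, hz.ae_eq] with ξ h1 h2
    rw [h1, h2]
  filter_upwards [ae_restrict_mem measurableSet_Ioi] with ξ hξ
  exact (h.eventuallyEq_of_mem (isOpen_Ioi.mem_nhds hξ)).deriv_eq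

theorem IsACRep.add (hc : ContinuousOn lam (Ici 0)) (hpos : ∀ ξ, 0 ≤ ξ → 0 < lam ξ)
    {x₁ x₂ : L2 lam} {y₁ y₂ : ℝ → ℂ} (h₁ : IsACRep lam x₁ y₁) (h₂ : IsACRep lam x₂ y₂) :
    IsACRep lam (x₁ + x₂) (y₁ + y₂) ∧
      ∀ᵐ ξ ∂halfLine, deriv (y₁ + y₂) ξ = deriv y₁ ξ + deriv y₂ ξ := by
  have hd : ∀ᵐ ξ ∂halfLine, deriv (y₁ + y₂) ξ = deriv y₁ ξ + deriv y₂ ξ := by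
    filter_upwards [h₁.locallyAC.ae_differentiableAt, h₂.locallyAC.ae_differentiableAt]
      with ξ a b
    exact deriv_add a b
  refine ⟨⟨fun a b hab hI => (h₁.locallyAC a b hab hI).add (h₂.locallyAC a b hab hI), ?_, ?_⟩, hd⟩
  · filter_upwards [h₁.ae_eq, h₂.ae_eq, ac_weighted hc hpos (Lp.coeFn_add x₁ x₂)] with ξ a b c
    rw [Pi.add_apply, a, b, c, Pi.add_apply, mul_add]
  · refine (h₁.memLp_deriv.add h₂.memLp_deriv).ae_eq ?_
    filter_upwards [weighted_ac hd] with ξ a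
    exact a.symm

theorem IsACRep.smul (hc : ContinuousOn lam (Ici 0)) (hpos : ∀ ξ, 0 ≤ ξ → 0 < lam ξ)
    (c : ℂ) {x : L2 lam} {y : ℝ → ℂ} (h : IsACRep lam x y) :
    IsACRep lam (c • x) (fun ξ => c • y ξ) ∧
      ∀ᵐ ξ ∂halfLine, deriv (fun ξ => c • y ξ) ξ = c • deriv y ξ := by
  have hd : ∀ᵐ ξ ∂halfLine, deriv (fun ξ => c • y ξ) ξ = c • deriv y ξ := by
    filter_upwards [h.locallyAC.ae_differentiableAt] with ξ a
    exact deriv_fun_const_smul c a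
  refine ⟨⟨fun a b hab hI => (h.locallyAC a b hab hI).const_smul c, ?_, ?_⟩, hd⟩
  · filter_upwards [h.ae_eq, ac_weighted hc hpos (Lp.coeFn_smul c x)] with ξ a b
    rw [a, b, Pi.smul_apply, smul_eq_mul, smul_eq_mul, mul_left_comm]
  · refine (h.memLp_deriv.const_smul c).ae_eq ?_
    filter_upwards [weighted_ac hd] with ξ a
    exact a.symm

theorem isACRep_zero (hc : ContinuousOn lam (Ici 0)) (hpos : ∀ ξ, 0 ≤ ξ → 0 < lam ξ) :
    IsACRep lam 0 0 := by
  refine ⟨fun a b _ _ => ?_, ?_, ?_⟩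
  · have h := (contDiff_const (𝕜 := ℝ) (n := 1) (c := (0 : ℂ))).contDiffOn (s := uIcc a b)
    exact h.absolutelyContinuousOnInterval
  · filter_upwards [ac_weighted hc hpos (Lp.coeFn_zero ℂ 2 (weighted lam))] with ξ a
    rw [a]; simp
  · have : deriv (0 : ℝ → ℂ) = 0 := by ext ξ; exact deriv_const ξ 0
    rw [this]; exact MemLp.zero

/-- The operator `A_lam x = (lam x)'` on `L²_lam(0, ∞)` with domain
`{x ∈ L²_lam(0, ∞) : lam x ∈ AC_loc[0, ∞) and (lam x)' ∈ L²_lam(0, ∞)}`. -/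
def transportOperator (lam : ℝ → ℝ) (hc : ContinuousOn lam (Ici 0))
    (hpos : ∀ ξ, 0 ≤ ξ → 0 < lam ξ) : L2 lam →ₗ.[ℂ] L2 lam where
  domain :=
    { carrier := {x | ∃ y : ℝ → ℂ, IsACRep lam x y}
      add_mem' := fun ⟨_, h₁⟩ ⟨_, h₂⟩ => ⟨_, (h₁.add hc hpos h₂).1⟩
      zero_mem' := ⟨_, isACRep_zero hc hpos⟩
      smul_mem' := fun c _ ⟨_, h⟩ => ⟨_, (h.smul hc hpos c).1⟩ }
  toFun :=
    { toFun := fun x => x.2.choose_spec.memLp_deriv.toLp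
      map_add' := by
        intro x₁ x₂
        obtain ⟨h, hd⟩ := x₁.2.choose_spec.add hc hpos x₂.2.choose_spec
        rw [← MemLp.toLp_add]
        refine (MemLp.toLp_eq_toLp_iff _ _).2 (weighted_ac ?_)
        filter_upwards [(x₁ + x₂).2.choose_spec.deriv_ae_eq h, hd] with ξ a b
        rw [a, b, Pi.add_apply]
      map_smul' := by
        intro c x
        obtain ⟨h, hd⟩ := x.2.choose_spec.smul hc hpos c
        rw [RingHom.id_apply, ← MemLp.toLp_const_smul]
        refine (MemLp.toLp_eq_toLp_iff _ _).2 (weighted_ac ?_)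
        filter_upwards [(c • x).2.choose_spec.deriv_ae_eq h, hd] with ξ a b
        rw [a, b, Pi.smul_apply] }

/-- The operator is given by `x ∈ D(A_lam)` and `A_lam x = z` if and only if `lam x` has a locally
absolutely continuous representative on `[0, ∞)` whose derivative is `z` almost everywhere. -/
theorem mem_graph_transportOperator (hc : ContinuousOn lam (Ici 0))
    (hpos : ∀ ξ, 0 ≤ ξ → 0 < lam ξ) (x z : L2 lam) :
    (x, z) ∈ (transportOperator lam hc hpos).graph ↔
      ∃ y : ℝ → ℂ, LocallyAC y (Ici 0) ∧ (∀ᵐ ξ ∂halfLine, y ξ = (lam ξ : ℂ) * x ξ) ∧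
        ∀ᵐ ξ ∂halfLine, deriv y ξ = z ξ := by
  rw [LinearPMap.mem_graph_iff]
  constructor
  · rintro ⟨x', rfl, hz⟩
    have h := x'.2.choose_spec
    refine ⟨_, h.locallyAC, h.ae_eq, ac_weighted hc hpos ?_⟩
    have h1 : z = h.memLp_deriv.toLp := hz.symm
    rw [h1]
    exact h.memLp_deriv.coeFn_toLp.symm
  · rintro ⟨y, h1, h2, h3⟩
    have h : IsACRep lam x y :=
      ⟨h1, h2, (Lp.memLp z).ae_eq (by filter_upwards [weighted_ac h3] with ξ a using a.symm)⟩
    refine ⟨⟨x, y, h⟩, rfl, ?_⟩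
    have hx : ∃ y : ℝ → ℂ, IsACRep lam x y := ⟨y, h⟩
    change hx.choose_spec.memLp_deriv.toLp = z
    refine Lp.ext (hx.choose_spec.memLp_deriv.coeFn_toLp.trans (weighted_ac ?_))
    filter_upwards [hx.choose_spec.deriv_ae_eq h, h3] with ξ a b
    rw [a, b]

/-! ## The characteristics -/

/-- `p_lam(ξ) = ∫_0^ξ lam(ζ)⁻¹ dζ`. -/
def travelTime (lam : ℝ → ℝ) (ξ : ℝ) : ℝ := ∫ ζ in (0 : ℝ)..ξ, (lam ζ)⁻¹

/-- The inverse of `p_lam : [0, ∞) → [0, ∞)`. -/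
def travelTimeInv (lam : ℝ → ℝ) : ℝ → ℝ := Function.invFunOn (travelTime lam) (Ici 0)

/-- `μ_lam(ξ, t) = p_lam⁻¹(p_lam(ξ) + t) - ξ`. -/
def displacement (lam : ℝ → ℝ) (ξ t : ℝ) : ℝ := travelTimeInv lam (travelTime lam ξ + t) - ξ

end

end WeightedTransport

/-! The substitution `s = p_lam(ξ)` together with multiplication by `lam` is an isometry of
`L²_lam(0, ∞)` onto `L²(0, ∞)`. It carries `A_lam` to `d/ds` and `T_lam(t)` to the left translation
by `t`, so that it suffices to identify the generator of the left translations. For a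
`C₀`-semigroup, `z` is the derivative at `0` of the orbit of `x` if and only if
`T(t) x - x = ∫₀ᵗ T(s) z ds` for all `t`. For left translation this says that, for each `t`,
`x(s + t) - x(s) = ∫ₛˢ⁺ᵗ z` for almost every `s`. Hence `x - ∫₀ z` is invariant under all
translations and therefore constant almost everywhere, which means that `x` is locally absolutely
continuous with derivative `z`. -/

namespace WeightedTransport

noncomputable section

section OrbitDerivative

variable {X Y : Type*} [NormedAddCommGroup X] [NormedSpace ℂ X]
  [NormedAddCommGroup Y] [NormedSpace ℂ Y] {T : ℝ≥0 → X →L[ℂ] X}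

/-- The orbit of `x` under `T` has the right derivative `z` at time `0`; this is the limit in
`IsGeneratorOf`. -/
def HasOrbitDeriv (T : ℝ≥0 → X →L[ℂ] X) (x z : X) : Prop :=
  Tendsto (fun t : ℝ≥0 => ((t : ℝ)⁻¹ : ℂ) • (T t x - x)) (𝓝[>] 0) (𝓝 z)

theorem IsC0Semigroup.continuous_orbit_toNNReal (hT : IsC0Semigroup T) (x : X) :
    Continuous fun t : ℝ => T t.toNNReal x :=
  (hT.continuous_orbit x).comp continuous_real_toNNReal

theorem hasOrbitDeriv_iff_hasDerivWithinAt (hT : IsC0Semigroup T) {x z : X} :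
    HasOrbitDeriv T x z ↔ HasDerivWithinAt (fun t : ℝ => T t.toNNReal x) z (Ioi 0) 0 := by
  have hslope (t : ℝ≥0) :
      slope (fun t : ℝ => T t.toNNReal x) 0 t = ((t : ℝ)⁻¹ : ℂ) • (T t x - x) := by
    rw [slope_def_module, sub_zero, Real.toNNReal_zero, Real.toNNReal_coe, hT.map_zero,
      ContinuousLinearMap.id_apply, ← Complex.ofReal_inv, Complex.coe_smul]
  rw [hasDerivWithinAt_iff_tendsto_slope' self_notMem_Ioi, ← NNReal.coe_zero,
    ← NNReal.map_coe_nhdsGT, tendsto_map'_iff]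
  exact (tendsto_congr hslope).symm

theorem IsC0Semigroup.hasDerivWithinAt (hT : IsC0Semigroup T) {x z : X}
    (h : HasOrbitDeriv T x z) {t : ℝ} (ht : 0 ≤ t) :
    HasDerivWithinAt (fun t : ℝ => T t.toNNReal x) (T t.toNNReal z) (Ioi t) t := by
  have hshift : HasDerivWithinAt (fun s : ℝ => T (s - t).toNNReal x) z (Ioi t) t := by
    have hsub : HasDerivWithinAt (fun s : ℝ => s - t) 1 (Ioi t) t :=
      (hasDerivWithinAt_id t _).sub_const t
    have hcomp := ((hasOrbitDeriv_iff_hasDerivWithinAt hT).1 h).scomp_of_eq t hsub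
      (fun s hs => mem_Ioi.2 (sub_pos.2 hs)) (sub_self t).symm
    rwa [one_smul] at hcomp
  have hfactor (s : ℝ) (hs : t ≤ s) :
      T s.toNNReal x = T t.toNNReal (T (s - t).toNNReal x) := by
    rw [← ContinuousLinearMap.comp_apply, ← hT.map_add, ← Real.toNNReal_add ht (sub_nonneg.2 hs),
      add_sub_cancel]
  exact ((T t.toNNReal).restrictScalars ℝ |>.hasFDerivAt.comp_hasDerivWithinAt t hshift).congr
    (fun s hs => hfactor s (le_of_lt hs)) (hfactor t le_rfl)

theorem IsC0Semigroup.hasOrbitDeriv_iff_integral [CompleteSpace X] (hT : IsC0Semigroup T)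
    {x z : X} :
    HasOrbitDeriv T x z ↔ ∀ t : ℝ≥0, T t x - x = ∫ s in (0 : ℝ)..t, T s.toNNReal z := by
  constructor
  · intro h t
    have hFTC := intervalIntegral.integral_eq_sub_of_hasDeriv_right_of_le t.coe_nonneg
      (hT.continuous_orbit_toNNReal x).continuousOn
      (fun s hs => hT.hasDerivWithinAt h hs.1.le)
      ((hT.continuous_orbit_toNNReal z).intervalIntegrable _ _)
    rw [hFTC, Real.toNNReal_coe, Real.toNNReal_zero, hT.map_zero, ContinuousLinearMap.id_apply]
  · intro h
    have horbit : HasDerivAt (fun t => x + ∫ s in (0 : ℝ)..t, T s.toNNReal z) z 0 := by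
      simpa [hT.map_zero] using ((hT.continuous_orbit_toNNReal z).integral_hasStrictDerivAt 0
        0).hasDerivAt.const_add x
    refine (hasOrbitDeriv_iff_hasDerivWithinAt hT).2
      (horbit.hasDerivWithinAt.congr (fun t ht => ?_) ?_)
    · lift t to ℝ≥0 using le_of_lt ht
      rw [← h, add_sub_cancel, Real.toNNReal_coe]
    · simp [hT.map_zero]

/-- The family `T` transported along `U`. -/
def conjBy (U : X ≃L[ℂ] Y) (T : ℝ≥0 → Y →L[ℂ] Y) (t : ℝ≥0) : X →L[ℂ] X :=
  U.symm ∘L T t ∘L U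

variable {S : ℝ≥0 → Y →L[ℂ] Y}

theorem IsC0Semigroup.conjBy (hS : IsC0Semigroup S) (U : X ≃L[ℂ] Y) :
    IsC0Semigroup (conjBy U S) where
  map_zero := by ext; simp [WeightedTransport.conjBy, hS.map_zero]
  map_add s t := by ext; simp [WeightedTransport.conjBy, hS.map_add]
  continuous_orbit x := U.symm.continuous.comp (hS.continuous_orbit (U x))

theorem hasOrbitDeriv_conjBy_iff (U : X ≃L[ℂ] Y) {x z : X} :
    HasOrbitDeriv (conjBy U S) x z ↔ HasOrbitDeriv S (U x) (U z) := by
  have h (t : ℝ≥0) : U (((t : ℝ)⁻¹ : ℂ) • (conjBy U S t x - x)) =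
      ((t : ℝ)⁻¹ : ℂ) • (S t (U x) - U x) := by simp [conjBy]
  simp only [HasOrbitDeriv, ← h]
  exact U.toHomeomorph.isInducing.tendsto_nhds_iff

end OrbitDerivative

section PointwiseIntegral

variable {α β E : Type*} [MeasurableSpace α] [MeasurableSpace β] {μ : Measure α} {ν : Measure β}
  [NormedAddCommGroup E] [NormedSpace ℝ E]

theorem exists_indicatorL1 (p : ℝ≥0∞) [Fact (1 ≤ p)] {s : Set β} (hs : MeasurableSet s)
    (hνs : ν s ≠ ∞) : ∃ J : Lp E p ν →L[ℝ] Lp E 1 ν, ∀ f, J f =ᵐ[ν] s.indicator f := by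
  have hpq : p.HolderConjugate p.conjExponent := .conjExponent Fact.out
  have : Fact (1 ≤ p.conjExponent) := ⟨hpq.symm.one_le⟩
  let B : E →L[ℝ] ℝ →L[ℝ] E := (ContinuousLinearMap.lsmul ℝ ℝ).flip
  refine ⟨(B.holderL ν p p.conjExponent 1).flip (indicatorConstLp _ hs hνs 1), fun f => ?_⟩
  filter_upwards [B.coeFn_holder (r := 1) f (indicatorConstLp p.conjExponent hs hνs 1),
    indicatorConstLp_coeFn (p := p.conjExponent) (hs := hs) (hμs := hνs) (c := (1 : ℝ))]
    with b hholder hind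
  by_cases hb : b ∈ s <;> simp [hholder, hind, hb, B]

variable [SFinite μ] [SigmaFinite ν] [CompleteSpace E]

theorem L1_integral_apply {F : α → Lp E 1 ν} {f : α → β → E}
    (hF : Integrable F μ) (hf : AEStronglyMeasurable (Function.uncurry f) (μ.prod ν))
    (hFf : ∀ᵐ a ∂μ, F a =ᵐ[ν] f a) : (∫ a, F a ∂μ : Lp E 1 ν) =ᵐ[ν] fun b => ∫ a, f a b ∂μ := by
  have hfint : Integrable (Function.uncurry f) (μ.prod ν) := by
    refine (integrable_prod_iff hf).2 ⟨?_, hF.norm.congr ?_⟩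
    · filter_upwards [hFf] with a ha using (L1.integrable_coeFn (F a)).congr ha
    · filter_upwards [hFf] with a ha
      rw [L1.norm_eq_integral_norm]
      exact integral_congr_ae (ha.fun_comp norm)
  refine ae_eq_of_forall_setIntegral_eq_of_sigmaFinite
    (fun s _ _ => (L1.integrable_coeFn _).integrableOn)
    (fun s _ _ => hfint.integral_prod_right.integrableOn) fun s _ _ => ?_
  let I : Lp E 1 ν →L[ℝ] E := L1.integralCLM ∘L LpToLpRestrictCLM β E ℝ ν 1 s
  have hI (g : Lp E 1 ν) : I g = ∫ b in s, g b ∂ν := by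
    rw [← integral_congr_ae (LpToLpRestrictCLM_coeFn ℝ s g), ← L1.integral_eq_integral]
    exact (L1.integral_eq _).symm
  calc ∫ b in s, (∫ a, F a ∂μ : Lp E 1 ν) b ∂ν = ∫ a, ∫ b in s, F a b ∂ν ∂μ := by
        simp_rw [← hI, I.integral_comp_comm hF]
    _ = ∫ a, ∫ b in s, f a b ∂ν ∂μ :=
        integral_congr_ae <| hFf.mono fun a ha => integral_congr_ae (ae_restrict_of_ae ha)
    _ = ∫ b in s, ∫ a, f a b ∂μ ∂ν :=
        integral_integral_swap <| hfint.mono_measure <|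
          Measure.prod_mono le_rfl Measure.restrict_le_self

theorem Lp_integral_apply {p : ℝ≥0∞} [Fact (1 ≤ p)] {F : α → Lp E p ν} {f : α → β → E}
    (hF : Integrable F μ) (hf : AEStronglyMeasurable (Function.uncurry f) (μ.prod ν))
    (hFf : ∀ᵐ a ∂μ, F a =ᵐ[ν] f a) : (∫ a, F a ∂μ : Lp E p ν) =ᵐ[ν] fun b => ∫ a, f a b ∂μ := by
  -- Restricting to sets of finite measure maps `Lᵖ` continuously to `L¹`, where Fubini applies.
  have hset (n : ℕ) : ∀ᵐ b ∂ν, b ∈ spanningSets ν n →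
      (∫ a, F a ∂μ : Lp E p ν) b = ∫ a, f a b ∂μ := by
    obtain ⟨J, hJ⟩ := exists_indicatorL1 (E := E) p (measurableSet_spanningSets ν n)
      (measure_spanningSets_lt_top ν n).ne
    have hind : Function.uncurry (fun a => (spanningSets ν n).indicator (f a)) =
        (univ ×ˢ spanningSets ν n).indicator (Function.uncurry f) := by
      ext ⟨a, b⟩; by_cases hb : b ∈ spanningSets ν n <;> simp [hb]
    have hL1 := L1_integral_apply (J.integrable_comp hF)
      (f := fun a => (spanningSets ν n).indicator (f a))
      (hind ▸ hf.indicator (MeasurableSet.univ.prod (measurableSet_spanningSets ν n)))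
      (hFf.mono fun a ha => (hJ _).trans (ha.indicator))
    rw [J.integral_comp_comm hF] at hL1
    filter_upwards [hL1, hJ (∫ a, F a ∂μ)] with b h₁ h₂ hb
    simpa [hb, h₁] using h₂.symm
  filter_upwards [ae_all_iff.2 hset] with b hb
  exact hb _ (mem_spanningSetsIndex ν b)

end PointwiseIntegral

section LeftShift

variable {E : Type*} [NormedAddCommGroup E]

theorem measurePreserving_add_right_halfLine (t : ℝ≥0) :
    MeasurePreserving (· + (t : ℝ)) halfLine (halfLine.restrict (Ioi (t : ℝ))) := by
  have h := (measurePreserving_add_right volume (t : ℝ)).restrict_preimage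
    (measurableSet_Ioi (a := (t : ℝ)))
  rw [preimage_add_const_Ioi, sub_self] at h
  rwa [Measure.restrict_restrict measurableSet_Ioi,
    inter_eq_self_of_subset_left (Ioi_subset_Ioi t.coe_nonneg)]

theorem ae_halfLine_add_right {q : ℝ → Prop} (hq : ∀ᵐ s ∂halfLine, q s) (t : ℝ≥0) :
    ∀ᵐ s ∂halfLine, q (s + t) :=
  (measurePreserving_add_right_halfLine t).quasiMeasurePreserving.ae (ae_restrict_of_ae hq)

theorem ae_eq_const_iff_forall_ae_add_right {w : ℝ → E} (hw : AEStronglyMeasurable w halfLine) :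
    (∃ c, ∀ᵐ s ∂halfLine, w s = c) ↔ ∀ t : ℝ≥0, ∀ᵐ s ∂halfLine, w (s + t) = w s := by
  refine ⟨fun ⟨c, hc⟩ t => ?_, fun h => ?_⟩
  · filter_upwards [hc, ae_halfLine_add_right hc t] with s h₁ h₂
    rw [h₁, h₂]
  have hmk (t : ℝ≥0) : ∀ᵐ s ∂halfLine, hw.mk w (s + t) = hw.mk w s := by
    filter_upwards [h t, hw.ae_eq_mk, ae_halfLine_add_right hw.ae_eq_mk t] with s h₁ h₂ h₃
    rw [← h₂, ← h₃, h₁]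
  -- By Fubini, one base point `s₀` satisfies `w (s₀ + t) = w s₀` for almost every `t`.
  have hswap : ∀ᵐ s ∂halfLine, ∀ᵐ t ∂halfLine, hw.mk w (s + t) = hw.mk w s := by
    have hmeas : MeasurableSet {q : ℝ × ℝ | hw.mk w (q.1 + q.2) = hw.mk w q.1} :=
      (hw.stronglyMeasurable_mk.comp_measurable measurable_add).measurableSet_eq_fun
        (hw.stronglyMeasurable_mk.comp_measurable measurable_fst)
    refine (Measure.ae_ae_comm hmeas).2 ?_
    filter_upwards [ae_restrict_mem measurableSet_Ioi] with t ht
    exact hmk ⟨t, le_of_lt ht⟩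
  have : (ae halfLine).NeBot := ae_neBot.2 (by simp [Measure.restrict_eq_zero])
  obtain ⟨s₀, hs₀, hpos : 0 < s₀⟩ := (hswap.and (ae_restrict_mem measurableSet_Ioi)).exists
  refine ⟨hw.mk w s₀, ?_⟩
  filter_upwards [hw.ae_eq_mk, hs₀, hmk ⟨s₀, hpos.le⟩] with s h₁ h₂ h₃
  rw [h₁, ← h₃, ← h₂, add_comm]
  rfl

theorem intervalIntegrable_of_Lp_halfLine {p : ℝ≥0∞} [Fact (1 ≤ p)]
    (f : Lp E p halfLine) {a b : ℝ} (ha : 0 ≤ a) (hb : 0 ≤ b) :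
    IntervalIntegrable f volume a b := by
  have h : uIoc a b ⊆ Ioi 0 := fun s hs => (le_min ha hb).trans_lt hs.1
  have : IsFiniteMeasure (volume.restrict (uIoc a b)) := ⟨by simp [uIoc]⟩
  exact intervalIntegrable_iff.2 <| ((Lp.memLp f).mono_measure
    (Measure.restrict_mono h le_rfl)).integrable (q := p) Fact.out

variable [NormedSpace ℂ E] {p : ℝ≥0∞} [Fact (1 ≤ p)]

/-- The left translation `(S(t) f)(s) = f(s + t)` on `Lᵖ(0, ∞)`. -/
def leftShift (E : Type*) [NormedAddCommGroup E] [NormedSpace ℂ E] (p : ℝ≥0∞) [Fact (1 ≤ p)]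
    (t : ℝ≥0) : Lp E p halfLine →L[ℂ] Lp E p halfLine :=
  (Lp.compMeasurePreservingₗᵢ ℂ (· + (t : ℝ))
    (measurePreserving_add_right_halfLine t)).toContinuousLinearMap ∘L
      LpToLpRestrictCLM ℝ E ℂ halfLine p (Ioi (t : ℝ))

theorem leftShift_apply_ae (t : ℝ≥0) (f : Lp E p halfLine) :
    ∀ᵐ s ∂halfLine, leftShift E p t f s = f (s + t) :=
  (Lp.coeFn_compMeasurePreserving _ (measurePreserving_add_right_halfLine t)).trans
    ((measurePreserving_add_right_halfLine t).quasiMeasurePreserving.ae_eq_comp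
      (LpToLpRestrictCLM_coeFn ℂ _ f))

theorem continuous_leftShift_apply (hp : p ≠ ∞) (f : Lp E p halfLine) :
    Continuous fun t : ℝ≥0 => leftShift E p t f := by
  have hmem : MemLp ((Ioi (0 : ℝ)).indicator f) p volume :=
    (memLp_indicator_iff_restrict measurableSet_Ioi).2 (Lp.memLp f)
  have hshift (t : ℝ≥0) : leftShift E p t f = LpToLpRestrictCLM ℝ E ℂ volume p (Ioi 0)
      (Lp.compMeasurePreserving (· + (t : ℝ)) (measurePreserving_add_right volume (t : ℝ))
        hmem.toLp) := by
    refine Lp.ext ?_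
    filter_upwards [leftShift_apply_ae t f, LpToLpRestrictCLM_coeFn ℂ (Ioi 0)
        (Lp.compMeasurePreserving _ (measurePreserving_add_right volume (t : ℝ)) hmem.toLp),
      ae_restrict_of_ae (Lp.coeFn_compMeasurePreserving hmem.toLp
        (measurePreserving_add_right volume (t : ℝ))),
      ae_restrict_of_ae ((measurePreserving_add_right volume (t : ℝ)).quasiMeasurePreserving.ae
        hmem.coeFn_toLp), ae_restrict_mem measurableSet_Ioi] with s h₁ h₂ h₃ h₄ hs
    rw [h₁, h₂, h₃, Function.comp_apply, h₄, indicator_of_mem]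
    exact add_pos_of_pos_of_nonneg hs t.coe_nonneg
  simp only [hshift]
  let F : C(ℝ≥0 × ℝ, ℝ) := ⟨fun q => q.2 + q.1, by fun_prop⟩
  exact (ContinuousLinearMap.continuous _).comp <|
    (continuous_const (y := hmem.toLp)).compMeasurePreservingLp F.curry.continuous
      (fun t => measurePreserving_add_right volume (t : ℝ)) hp

theorem isC0Semigroup_leftShift (hp : p ≠ ∞) : IsC0Semigroup (leftShift E p) where
  map_zero := by
    ext1 f
    refine Lp.ext ((leftShift_apply_ae 0 f).mono fun s hs => ?_)
    rw [hs, NNReal.coe_zero, add_zero, ContinuousLinearMap.id_apply]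
  map_add s t := by
    ext1 f
    refine Lp.ext ?_
    filter_upwards [leftShift_apply_ae (s + t) f, leftShift_apply_ae s (leftShift E p t f),
      ae_halfLine_add_right (leftShift_apply_ae t f) s] with r h₁ h₂ h₃
    rw [h₁, ContinuousLinearMap.comp_apply, h₂, h₃, NNReal.coe_add, add_assoc]
  continuous_orbit := continuous_leftShift_apply hp

variable [CompleteSpace E]

theorem integral_leftShift_apply_ae (hp : p ≠ ∞) (h : Lp E p halfLine) (t : ℝ≥0) :
    ∀ᵐ s ∂halfLine, (∫ r in (0 : ℝ)..t, leftShift E p r.toNNReal h) s =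
      ∫ r in s..(s + t), h r := by
  have hcont : Continuous fun r : ℝ => leftShift E p r.toNNReal h :=
    (isC0Semigroup_leftShift hp).continuous_orbit_toNNReal h
  have heval : ∀ᵐ r ∂volume.restrict (Ioc (0 : ℝ) t),
      leftShift E p r.toNNReal h =ᵐ[halfLine] fun s => h (s + r) := by
    filter_upwards [ae_restrict_mem measurableSet_Ioc] with r hr
    have hr' := leftShift_apply_ae r.toNNReal h
    rwa [Real.coe_toNNReal r hr.1.le] at hr'
  have hmeas : StronglyMeasurable (Function.uncurry fun r s : ℝ => h (s + r)) :=
    (Lp.stronglyMeasurable h).comp_measurable (measurable_snd.add measurable_fst)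
  filter_upwards [Lp_integral_apply hcont.integrableOn_Ioc hmeas.aestronglyMeasurable heval]
    with s hs
  rw [intervalIntegral.integral_of_le t.coe_nonneg, hs,
    ← intervalIntegral.integral_of_le t.coe_nonneg,
    intervalIntegral.integral_comp_add_left (fun r => h r) s, add_zero]

theorem hasOrbitDeriv_leftShift_iff (hp : p ≠ ∞) {g h : Lp E p halfLine} :
    HasOrbitDeriv (leftShift E p) g h ↔
      ∃ c, ∀ᵐ s ∂halfLine, g s = c + ∫ r in (0 : ℝ)..s, h r := by
  have hprim : ContinuousOn (fun s => ∫ r in (0 : ℝ)..s, h r) (Ioi 0) := by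
    refine fun s (hs : 0 < s) => ContinuousAt.continuousWithinAt ?_
    have hint := intervalIntegrable_of_Lp_halfLine h le_rfl (by positivity : 0 ≤ s + 1)
    exact (intervalIntegral.continuousOn_primitive_interval' hint left_mem_uIcc).continuousAt
      (by rw [uIcc_of_le (by positivity)]; exact Icc_mem_nhds hs (lt_add_one s))
  have hw : AEStronglyMeasurable (fun s => g s - ∫ r in (0 : ℝ)..s, h r) halfLine :=
    (Lp.aestronglyMeasurable g).sub (hprim.aestronglyMeasurable measurableSet_Ioi)
  simp only [← sub_eq_iff_eq_add]
  rw [(isC0Semigroup_leftShift hp).hasOrbitDeriv_iff_integral,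
    ae_eq_const_iff_forall_ae_add_right hw]
  refine forall_congr' fun t => ?_
  rw [Lp.ext_iff]
  refine eventually_congr ?_
  filter_upwards [Lp.coeFn_sub (leftShift E p t g) g, leftShift_apply_ae t g,
    integral_leftShift_apply_ae hp h t, ae_restrict_mem measurableSet_Ioi] with s h₁ h₂ h₃ hs
  have hadd := intervalIntegral.integral_add_adjacent_intervals
    (intervalIntegrable_of_Lp_halfLine h le_rfl (le_of_lt hs))
    (intervalIntegrable_of_Lp_halfLine h (le_of_lt hs) (add_nonneg (le_of_lt hs) t.coe_nonneg))
  refine (Eq.congr (h₁.trans (congrArg (· - g s) h₂)) h₃).trans ?_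
  grind

end LeftShift

section Primitive

theorem absolutelyContinuousOnInterval_of_dist_le {X Y : Type*} [PseudoMetricSpace X]
    [PseudoMetricSpace Y] {f : ℝ → X} {g : ℝ → Y} {a b : ℝ}
    (hg : AbsolutelyContinuousOnInterval g a b)
    (hfg : ∀ r ∈ uIcc a b, ∀ s ∈ uIcc a b, dist (f r) (f s) ≤ dist (g r) (g s)) :
    AbsolutelyContinuousOnInterval f a b := by
  rw [absolutelyContinuousOnInterval_iff] at hg ⊢
  refine fun ε hε => (hg ε hε).imp fun δ ⟨hδ, h⟩ => ⟨hδ, fun I hI hlen => ?_⟩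
  exact (Finset.sum_le_sum fun i hi => hfg _ (hI.1 i hi).1 _ (hI.1 i hi).2).trans_lt (h I hI hlen)

variable {E : Type*} [NormedAddCommGroup E] [NormedSpace ℝ E]

theorem absolutelyContinuousOnInterval_integral {f : ℝ → E} {a b c : ℝ}
    (hf : IntervalIntegrable f volume a b) (hc : c ∈ uIcc a b) :
    AbsolutelyContinuousOnInterval (fun r => ∫ v in c..r, f v) a b := by
  refine absolutelyContinuousOnInterval_of_dist_le
    (hf.norm.absolutelyContinuousOnInterval_intervalIntegral hc) fun r hr s hs => ?_
  have hint {u : ℝ} (hu : u ∈ uIcc a b) : IntervalIntegrable f volume c u :=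
    hf.mono_set (uIcc_subset_uIcc hc hu)
  rw [dist_eq_norm, dist_eq_norm, intervalIntegral.integral_interval_sub_left (hint hr) (hint hs),
    intervalIntegral.integral_interval_sub_left (hint hr).norm (hint hs).norm, Real.norm_eq_abs]
  exact intervalIntegral.norm_integral_le_abs_integral_norm

theorem sub_eq_integral_of_ae_hasDerivAt [CompleteSpace E] {f g : ℝ → E} {a b : ℝ}
    (hf : AbsolutelyContinuousOnInterval f a b) (hg : IntervalIntegrable g volume a b)
    (hfg : ∀ᵐ r, r ∈ uIcc a b → HasDerivAt f (g r) r) : f b - f a = ∫ v in a..b, g v := by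
  have hzero : ∀ᵐ r, r ∈ uIcc a b → HasDerivAt (f - fun r => ∫ v in a..r, g v) 0 r := by
    filter_upwards [hfg, hg.ae_hasDerivAt_integral] with r hfr hgr hr
    simpa using (hfr hr).sub (hgr hr a left_mem_uIcc)
  obtain ⟨c, hc⟩ := (hf.sub (absolutelyContinuousOnInterval_integral hg
    left_mem_uIcc)).const_of_ae_hasDerivAt_zero hzero
  simpa [sub_eq_iff_eq_add, add_comm] using (hc b right_mem_uIcc).trans (hc a left_mem_uIcc).symm

theorem ae_halfLine_hasDerivAt_integral [CompleteSpace E] {z : ℝ → E}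
    (hz : ∀ b, 0 ≤ b → IntervalIntegrable z volume 0 b) :
    ∀ᵐ ξ ∂halfLine, HasDerivAt (fun r => ∫ v in (0 : ℝ)..r, z v) (z ξ) ξ := by
  rw [ae_restrict_iff' measurableSet_Ioi]
  filter_upwards [ae_all_iff.2 fun n : ℕ => (hz n n.cast_nonneg).ae_hasDerivAt_integral]
    with ξ hξ (hpos : 0 < ξ)
  obtain ⟨n, hn⟩ := exists_nat_ge ξ
  exact hξ n (mem_uIcc_of_le hpos.le hn) 0 left_mem_uIcc

theorem locallyAC_const_add_integral {z : ℝ → ℂ}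
    (hz : ∀ b, 0 ≤ b → IntervalIntegrable z volume 0 b) (c : ℂ) :
    LocallyAC (fun ξ => c + ∫ v in (0 : ℝ)..ξ, z v) (Ici 0) := by
  intro a b hab hI
  have ha : 0 ≤ a := hI (left_mem_Icc.2 hab)
  refine absolutelyContinuousOnInterval_of_dist_le
    ((absolutelyContinuousOnInterval_integral (hz b (ha.trans hab)) left_mem_uIcc).mono ?_)
    fun r _ s _ => (dist_add_left c _ _).le
  rw [uIcc_of_le hab, uIcc_of_le (ha.trans hab)]
  exact Icc_subset_Icc_left ha

theorem LocallyAC.eq_add_integral {y z : ℝ → ℂ} (hy : LocallyAC y (Ici 0))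
    (hz : ∀ b, 0 ≤ b → IntervalIntegrable z volume 0 b) (hyz : ∀ᵐ ξ ∂halfLine, deriv y ξ = z ξ)
    {ξ : ℝ} (hξ : 0 ≤ ξ) : y ξ = y 0 + ∫ v in (0 : ℝ)..ξ, z v := by
  have hderiv : ∀ᵐ r ∂halfLine, HasDerivAt y (z r) r := by
    filter_upwards [hyz, hy.ae_differentiableAt] with r hr hd
    exact hr ▸ hd.hasDerivAt
  rw [ae_restrict_iff' measurableSet_Ioi] at hderiv
  rw [← sub_eq_iff_eq_add']
  refine sub_eq_integral_of_ae_hasDerivAt (hy 0 ξ hξ Icc_subset_Ici_self) (hz ξ hξ) ?_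
  filter_upwards [hderiv, Measure.ae_ne volume 0] with r hr hne hmem
  rw [uIcc_of_le hξ] at hmem
  exact hr (hmem.1.lt_of_ne' hne)

variable {lam : ℝ → ℝ}

theorem mem_graph_transportOperator_iff_integral (hc : ContinuousOn lam (Ici 0))
    (hpos : ∀ ξ, 0 ≤ ξ → 0 < lam ξ) {x z : L2 lam}
    (hz : ∀ b, 0 ≤ b → IntervalIntegrable z volume 0 b) :
    (x, z) ∈ (transportOperator lam hc hpos).graph ↔
      ∃ c, ∀ᵐ ξ ∂halfLine, (lam ξ : ℂ) * x ξ = c + ∫ v in (0 : ℝ)..ξ, z v := by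
  rw [mem_graph_transportOperator]
  constructor
  · rintro ⟨y, hy, hyx, hyz⟩
    refine ⟨y 0, ?_⟩
    filter_upwards [hyx, ae_restrict_mem measurableSet_Ioi] with ξ h hξ
    rw [← h, hy.eq_add_integral hz hyz (le_of_lt hξ)]
  · rintro ⟨c, h⟩
    refine ⟨_, locallyAC_const_add_integral hz c, h.mono fun _ => Eq.symm, ?_⟩
    filter_upwards [ae_halfLine_hasDerivAt_integral hz] with ξ hξ
    exact (hξ.const_add c).deriv

end Primitive

section LpEquiv

variable {α β 𝕜 E : Type*} [MeasurableSpace α] [MeasurableSpace β] {μ ν : Measure α}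
  {μ' : Measure β} [NormedField 𝕜] [NormedAddCommGroup E] [NormedSpace 𝕜 E] {p : ℝ≥0∞} {w : α → 𝕜}

theorem eLpNorm_withDensity_enorm_rpow (hp₀ : p ≠ 0) (hp : p ≠ ∞) (hw : AEStronglyMeasurable w ν)
    (f : α → E) :
    eLpNorm f p (ν.withDensity fun a => ‖w a‖ₑ ^ p.toReal) = eLpNorm (w • f) p ν := by
  rw [eLpNorm_eq_lintegral_rpow_enorm_toReal hp₀ hp, eLpNorm_eq_lintegral_rpow_enorm_toReal hp₀ hp,
    lintegral_withDensity_eq_lintegral_mul_non_measurable₀ _ (hw.enorm.pow_const _)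
      (ae_of_all _ fun _ => ENNReal.rpow_lt_top_of_nonneg ENNReal.toReal_nonneg enorm_ne_top)]
  simp only [Pi.mul_apply, Pi.smul_apply', enorm_smul, ENNReal.mul_rpow_of_nonneg _ _
    ENNReal.toReal_nonneg]

theorem absolutelyContinuous_withDensity_enorm_rpow (hw : AEStronglyMeasurable w ν)
    (hw₀ : ∀ᵐ a ∂ν, w a ≠ 0) : ν ≪ ν.withDensity fun a => ‖w a‖ₑ ^ p.toReal :=
  withDensity_absolutelyContinuous' (hw.enorm.pow_const _) <| hw₀.mono fun _ ha =>
    (ENNReal.rpow_pos (enorm_pos.2 ha) enorm_ne_top).ne'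

theorem memLp_withDensity_enorm_rpow_iff (hp₀ : p ≠ 0) (hp : p ≠ ∞)
    (hw : AEStronglyMeasurable w ν) (hw₀ : ∀ᵐ a ∂ν, w a ≠ 0) {f : α → E} :
    MemLp f p (ν.withDensity fun a => ‖w a‖ₑ ^ p.toReal) ↔ MemLp (w • f) p ν := by
  have hmeas : AEStronglyMeasurable f (ν.withDensity fun a => ‖w a‖ₑ ^ p.toReal) ↔
      AEStronglyMeasurable (w • f) ν := by
    refine ⟨fun hf => hw.smul (hf.mono_ac (absolutelyContinuous_withDensity_enorm_rpow hw hw₀)),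
      fun hf => ((hw.inv₀.smul hf).congr ?_).mono_ac (withDensity_absolutelyContinuous _ _)⟩
    filter_upwards [hw₀] with a ha using inv_smul_smul₀ ha (f a)
  rw [MemLp, MemLp, hmeas, eLpNorm_withDensity_enorm_rpow hp₀ hp hw]

variable [Fact (1 ≤ p)]

/-- Multiplication by `w`, as an isometry from `Lᵖ(|w|ᵖ ν)` to `Lᵖ(ν)`; the measure `|w|ᵖ ν` is
a separate variable because `Lp` depends on its syntactic form. -/
def smulLpₗᵢ (hp : p ≠ ∞) (hw : AEStronglyMeasurable w ν) (hw₀ : ∀ᵐ a ∂ν, w a ≠ 0)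
    (hμ : μ = ν.withDensity fun a => ‖w a‖ₑ ^ p.toReal) : Lp E p μ →ₗᵢ[𝕜] Lp E p ν :=
  have hp₀ : p ≠ 0 := (one_pos.trans_le Fact.out).ne'
  have hνμ : ν ≪ μ := hμ ▸ absolutelyContinuous_withDensity_enorm_rpow hw hw₀
  have hmem (f : Lp E p μ) : MemLp (w • ⇑f) p ν :=
    (memLp_withDensity_enorm_rpow_iff hp₀ hp hw hw₀).1 (hμ ▸ Lp.memLp f)
  { toFun f := (hmem f).toLp
    map_add' f g := by
      rw [← MemLp.toLp_add, MemLp.toLp_eq_toLp_iff]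
      filter_upwards [hνμ (Lp.coeFn_add f g)] with a ha
      simp only [Pi.smul_apply', ha, Pi.add_apply, smul_add]
    map_smul' c f := by
      rw [RingHom.id_apply, ← MemLp.toLp_const_smul, MemLp.toLp_eq_toLp_iff]
      filter_upwards [hνμ (Lp.coeFn_smul c f)] with a ha
      simp only [Pi.smul_apply', ha, Pi.smul_apply, smul_comm c]
    norm_map' f := by
      subst hμ
      exact (Lp.norm_toLp _ (hmem f)).trans <| congrArg ENNReal.toReal
        (eLpNorm_withDensity_enorm_rpow hp₀ hp hw f).symm }

theorem smulLpₗᵢ_apply_ae (hp : p ≠ ∞) (hw : AEStronglyMeasurable w ν)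
    (hw₀ : ∀ᵐ a ∂ν, w a ≠ 0) (hμ : μ = ν.withDensity fun a => ‖w a‖ₑ ^ p.toReal) (f : Lp E p μ) :
    ∀ᵐ a ∂ν, smulLpₗᵢ hp hw hw₀ hμ f a = w a • f a :=
  MemLp.coeFn_toLp ((memLp_withDensity_enorm_rpow_iff (one_pos.trans_le Fact.out).ne' hp hw hw₀).1
    (hμ ▸ Lp.memLp f))

theorem smulLpₗᵢ_surjective (hp : p ≠ ∞) (hw : AEStronglyMeasurable w ν)
    (hw₀ : ∀ᵐ a ∂ν, w a ≠ 0) (hμ : μ = ν.withDensity fun a => ‖w a‖ₑ ^ p.toReal) :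
    Function.Surjective (smulLpₗᵢ (E := E) hp hw hw₀ hμ) := by
  intro g
  have hcancel : w • w⁻¹ • ⇑g =ᵐ[ν] g := hw₀.mono fun a ha => smul_inv_smul₀ ha (g a)
  have hmem : MemLp (w⁻¹ • ⇑g) p μ := hμ ▸ (memLp_withDensity_enorm_rpow_iff
    (one_pos.trans_le Fact.out).ne' hp hw hw₀).2 ((Lp.memLp g).ae_eq hcancel.symm)
  refine ⟨hmem.toLp, Lp.ext ?_⟩
  have hνμ : ν ≪ μ := hμ ▸ absolutelyContinuous_withDensity_enorm_rpow hw hw₀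
  filter_upwards [smulLpₗᵢ_apply_ae hp hw hw₀ hμ hmem.toLp, hνμ hmem.coeFn_toLp, hcancel]
    with a h₁ h₂ h₃
  rw [h₁, h₂, ← h₃]
  rfl

/-- `smulLpₗᵢ` as an isometric equivalence. -/
def smulLpEquiv (hp : p ≠ ∞) (hw : AEStronglyMeasurable w ν) (hw₀ : ∀ᵐ a ∂ν, w a ≠ 0)
    (hμ : μ = ν.withDensity fun a => ‖w a‖ₑ ^ p.toReal) : Lp E p μ ≃ₗᵢ[𝕜] Lp E p ν :=
  .ofSurjective _ (smulLpₗᵢ_surjective hp hw hw₀ hμ)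

theorem compMeasurePreservingₗᵢ_surjective (e : α ≃ᵐ β) (he : MeasurePreserving e μ μ') :
    Function.Surjective (Lp.compMeasurePreservingₗᵢ 𝕜 e he : Lp E p μ' →ₗᵢ[𝕜] Lp E p μ) := by
  intro f
  refine ⟨Lp.compMeasurePreserving e.symm (he.symm e) f, Lp.ext ?_⟩
  filter_upwards [Lp.coeFn_compMeasurePreserving (Lp.compMeasurePreserving e.symm (he.symm e) f) he,
    he.quasiMeasurePreserving.ae (Lp.coeFn_compMeasurePreserving f (he.symm e))] with a h₁ h₂
  exact h₁.trans (h₂.trans (congrArg f (e.symm_apply_apply a)))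

/-- Composition with a measure preserving equivalence, as an isometric equivalence of `Lᵖ`
spaces. -/
def compLpEquiv (𝕜 : Type*) [NormedField 𝕜] [NormedSpace 𝕜 E] (e : α ≃ᵐ β)
    (he : MeasurePreserving e μ μ') : Lp E p μ' ≃ₗᵢ[𝕜] Lp E p μ :=
  .ofSurjective _ (compMeasurePreservingₗᵢ_surjective e he)

end LpEquiv

section Characteristics

theorem exists_orderIso_eq_integral {ρ : ℝ → ℝ} (hρ : Continuous ρ) (hpos : ∀ ξ, 0 < ρ ξ)
    (htop : ¬ IntegrableOn ρ (Ioi 0)) (hbot : ¬ IntegrableOn ρ (Iic 0)) :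
    ∃ P : ℝ ≃o ℝ, ∀ ξ, P ξ = ∫ ζ in (0 : ℝ)..ξ, ρ ζ := by
  let p : ℝ → ℝ := fun ξ => ∫ ζ in (0 : ℝ)..ξ, ρ ζ
  have hderiv (ξ : ℝ) : HasDerivAt p (ρ ξ) ξ := (hρ.integral_hasStrictDerivAt 0 ξ).hasDerivAt
  have hmono : StrictMono p := strictMono_of_deriv_pos fun ξ => (hderiv ξ).deriv ▸ hpos ξ
  have hnorm (ζ : ℝ) : ‖ρ ζ‖ = ρ ζ := Real.norm_of_nonneg (hpos ζ).le
  have hp_top : Tendsto p atTop atTop := by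
    refine tendsto_atTop_atTop_of_monotone hmono.monotone fun b => ?_
    by_contra! hb
    refine htop (integrableOn_Ioi_of_intervalIntegral_norm_bounded b 0
      (fun _ => hρ.integrableOn_Ioc) tendsto_id (.of_forall fun ξ => ?_))
    simpa only [hnorm] using! (hb ξ).le
  have hp_bot : Tendsto p atBot atBot := by
    refine tendsto_atBot_atBot_of_monotone hmono.monotone fun b => ?_
    by_contra! hb
    refine hbot (integrableOn_Iic_of_intervalIntegral_norm_bounded (-b) 0
      (fun _ => hρ.integrableOn_Ioc) tendsto_id (.of_forall fun ξ => ?_))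
    simpa only [hnorm, intervalIntegral.integral_symm 0 (id ξ)] using! neg_le_neg (hb ξ).le
  have hcont : Continuous p := continuous_iff_continuousAt.2 fun ξ => (hderiv ξ).continuousAt
  exact ⟨hmono.orderIsoOfSurjective p (hcont.surjective hp_top hp_bot), fun _ => rfl⟩

theorem measurePreserving_of_hasDerivAt {ρ : ℝ → ℝ} {P : ℝ ≃o ℝ} (hP₀ : P 0 = 0)
    (hP : ∀ ξ, 0 < ξ → HasDerivAt P (ρ ξ) ξ) : MeasurePreserving P (weighted ρ) halfLine := by
  refine ⟨P.continuous.measurable, Measure.ext fun s hs => ?_⟩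
  have hs' : MeasurableSet (P ⁻¹' s) := P.continuous.measurable hs
  have himage : P '' (P ⁻¹' s ∩ Ioi 0) = s ∩ Ioi 0 := by
    rw [image_inter P.injective, P.image_Ioi, hP₀, image_preimage_eq _ P.surjective]
  rw [Measure.map_apply P.continuous.measurable hs, weighted, withDensity_apply _ hs', halfLine,
    Measure.restrict_restrict hs', Measure.restrict_apply hs, ← himage]
  exact lintegral_deriv_eq_volume_image_of_monotoneOn (hs'.inter measurableSet_Ioi)
    (fun ξ hξ => (hP ξ hξ.2).hasDerivWithinAt) (P.monotone.monotoneOn _)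

/-- `P` extends the travel time `p_lam` of the continuous positive speed `lam` on `[0, ∞)` to an
order automorphism of `ℝ`. -/
structure IsTravelTime (lam : ℝ → ℝ) (P : ℝ ≃o ℝ) : Prop where
  continuousOn : ContinuousOn lam (Ici 0)
  pos : ∀ ξ, 0 ≤ ξ → 0 < lam ξ
  eqOn : EqOn P (travelTime lam) (Ici 0)

variable {lam : ℝ → ℝ} {P : ℝ ≃o ℝ}

theorem exists_isTravelTime (hc : ContinuousOn lam (Ici 0)) (hpos : ∀ ξ, 0 ≤ ξ → 0 < lam ξ)
    (hint : ¬ IntegrableOn (fun ξ => 1 / lam ξ) (Ioi 0)) : ∃ P, IsTravelTime lam P := by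
  have hcont : Continuous fun ξ => (lam (max ξ 0))⁻¹ :=
    (hc.comp_continuous (by fun_prop) fun ξ => le_max_right ξ 0).inv₀
      fun ξ => (hpos _ (le_max_right ξ 0)).ne'
  have htop : ¬ IntegrableOn (fun ξ => (lam (max ξ 0))⁻¹) (Ioi 0) := fun h =>
    hint <| h.congr_fun (fun ξ (hξ : 0 < ξ) => by simp [hξ.le]) measurableSet_Ioi
  have hbot : ¬ IntegrableOn (fun ξ => (lam (max ξ 0))⁻¹) (Iic 0) := fun h => by
    have hconst : IntegrableOn (fun _ : ℝ => (lam 0)⁻¹) (Iic 0) :=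
      h.congr_fun (fun ξ (hξ : ξ ≤ 0) => by simp [hξ]) measurableSet_Iic
    simp [integrableOn_const_iff, (hpos 0 le_rfl).ne'] at hconst
  obtain ⟨P, hP⟩ := exists_orderIso_eq_integral hcont
    (fun ξ => inv_pos.2 (hpos _ (le_max_right ξ 0))) htop hbot
  refine ⟨P, hc, hpos, fun ξ (hξ : 0 ≤ ξ) => (hP ξ).trans <|
    intervalIntegral.integral_congr fun ζ hζ => ?_⟩
  rw [uIcc_of_le hξ] at hζ
  simp only [max_eq_left hζ.1]

namespace IsTravelTime

theorem map_zero (h : IsTravelTime lam P) : P 0 = 0 :=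
  (h.eqOn self_mem_Ici).trans intervalIntegral.integral_same

theorem bijOn (h : IsTravelTime lam P) : BijOn (travelTime lam) (Ici 0) (Ici 0) := by
  have hP : BijOn P (Ici 0) (P '' Ici 0) := P.injective.injOn.bijOn_image
  rw [P.image_Ici, h.map_zero] at hP
  exact hP.congr h.eqOn

theorem travelTimeInv_eq (h : IsTravelTime lam P) {s : ℝ} (hs : 0 ≤ s) :
    travelTimeInv lam s = P.symm s := by
  have hex : ∃ ξ ∈ Ici 0, travelTime lam ξ = s := h.bijOn.surjOn hs
  rw [P.eq_symm_apply, travelTimeInv, h.eqOn (Function.invFunOn_mem hex)]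
  exact Function.invFunOn_eq hex

theorem add_displacement (h : IsTravelTime lam P) {ξ t : ℝ} (hξ : 0 ≤ ξ) (ht : 0 ≤ t) :
    ξ + displacement lam ξ t = P.symm (P ξ + t) := by
  have hPξ : 0 ≤ P ξ := h.map_zero ▸ P.monotone hξ
  rw [displacement, add_sub_cancel, ← h.eqOn hξ, h.travelTimeInv_eq (add_nonneg hPξ ht)]

theorem hasDerivAt (h : IsTravelTime lam P) {ξ : ℝ} (hξ : 0 < ξ) :
    HasDerivAt P (lam ξ)⁻¹ ξ := by
  have hcont : ContinuousOn (fun ζ => (lam ζ)⁻¹) (Ici 0) :=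
    h.continuousOn.inv₀ fun ζ hζ => (h.pos ζ hζ).ne'
  have hint : IntervalIntegrable (fun ζ => (lam ζ)⁻¹) volume 0 ξ :=
    (hcont.mono (uIcc_of_le hξ.le ▸ Icc_subset_Ici_self)).intervalIntegrable
  refine (intervalIntegral.integral_hasDerivAt_right hint
    (hcont.mono Ioi_subset_Ici_self |>.stronglyMeasurableAtFilter isOpen_Ioi ξ hξ)
    (hcont.continuousAt (Ici_mem_nhds hξ))).congr_of_eventuallyEq ?_
  filter_upwards [Ici_mem_nhds hξ] with ζ hζ using h.eqOn hζ

theorem measurePreserving (h : IsTravelTime lam P) :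
    MeasurePreserving P (weighted fun ξ => (lam ξ)⁻¹) halfLine :=
  measurePreserving_of_hasDerivAt h.map_zero fun _ => h.hasDerivAt

theorem halfLine_ac_weighted_inv (h : IsTravelTime lam P) :
    halfLine ≪ weighted fun ξ => (lam ξ)⁻¹ :=
  ac_weighted (h.continuousOn.inv₀ fun ξ hξ => (h.pos ξ hξ).ne')
    fun ξ hξ => inv_pos.2 (h.pos ξ hξ)

theorem ae_comp_iff (h : IsTravelTime lam P) {q : ℝ → Prop} :
    (∀ᵐ ξ ∂halfLine, q (P ξ)) ↔ ∀ᵐ s ∂halfLine, q s := by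
  have hae : ae halfLine = ae (weighted fun ξ => (lam ξ)⁻¹) :=
    le_antisymm h.halfLine_ac_weighted_inv.ae_le weighted_ac.ae_le
  conv_rhs => rw [← h.measurePreserving.map_eq]
  rw [hae, ← eventually_map (m := P) (P := q)]
  exact P.toHomeomorph.toMeasurableEquiv.map_ae _ ▸ Iff.rfl

end IsTravelTime

end Characteristics

section Flatten

variable {lam : ℝ → ℝ} {P : ℝ ≃o ℝ}

namespace IsTravelTime

theorem aestronglyMeasurable_ofReal (h : IsTravelTime lam P) :
    AEStronglyMeasurable (fun ξ => (lam ξ : ℂ)) (weighted fun ξ => (lam ξ)⁻¹) :=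
  ((Complex.continuous_ofReal.comp_continuousOn
    (h.continuousOn.mono Ioi_subset_Ici_self)).aestronglyMeasurable measurableSet_Ioi).mono_ac
    weighted_ac

theorem ae_ne_zero (h : IsTravelTime lam P) : ∀ᵐ ξ ∂halfLine, (lam ξ : ℂ) ≠ 0 := by
  filter_upwards [ae_restrict_mem measurableSet_Ioi] with ξ hξ
  exact Complex.ofReal_ne_zero.2 (h.pos ξ (le_of_lt hξ)).ne'

theorem weighted_eq_withDensity_inv (h : IsTravelTime lam P) :
    weighted lam =
      (weighted fun ξ => (lam ξ)⁻¹).withDensity fun ξ => ‖(lam ξ : ℂ)‖ₑ ^ (2 : ℝ≥0∞).toReal := by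
  have hlam : AEMeasurable lam halfLine :=
    (h.continuousOn.mono Ioi_subset_Ici_self).aemeasurable measurableSet_Ioi
  rw [weighted, weighted, ← withDensity_mul₀ (f := fun ξ => ENNReal.ofReal (lam ξ)⁻¹)
    hlam.inv.ennreal_ofReal
    (hlam.complex_ofReal.enorm.pow_const _)]
  refine withDensity_congr_ae ?_
  filter_upwards [ae_restrict_mem measurableSet_Ioi] with ξ hξ
  have hξ' := h.pos ξ (le_of_lt hξ)
  rw [Pi.mul_apply, ← ofReal_norm, Complex.norm_of_nonneg hξ'.le, ENNReal.toReal_ofNat,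
    ENNReal.rpow_two, ← ENNReal.ofReal_pow hξ'.le, ← ENNReal.ofReal_mul (inv_pos.2 hξ').le]
  congr 1
  field_simp

/-- The isometry `x ↦ (lam x) ∘ P⁻¹` of `L²_lam(0, ∞)` onto `L²(0, ∞)`, which turns
`transportOperator` into `d/ds`. It factors through `L²` of the weight `1 / lam`. -/
def flatten (h : IsTravelTime lam P) : L2 lam ≃L[ℂ] Lp ℂ 2 halfLine :=
  let smul := smulLpEquiv ENNReal.ofNat_ne_top h.aestronglyMeasurable_ofReal
    (weighted_ac h.ae_ne_zero) h.weighted_eq_withDensity_inv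
  let comp := compLpEquiv ℂ P.toHomeomorph.toMeasurableEquiv h.measurePreserving
  (smul.trans comp.symm).toContinuousLinearEquiv

theorem flatten_apply_ae (h : IsTravelTime lam P) (x : L2 lam) :
    ∀ᵐ ξ ∂halfLine, h.flatten x (P ξ) = lam ξ * x ξ := by
  let y : L2 fun ξ => (lam ξ)⁻¹ := smulLpₗᵢ ENNReal.ofNat_ne_top h.aestronglyMeasurable_ofReal
    (weighted_ac h.ae_ne_zero) h.weighted_eq_withDensity_inv x
  have hcomp : Lp.compMeasurePreserving P h.measurePreserving (h.flatten x) = y :=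
    (compLpEquiv ℂ P.toHomeomorph.toMeasurableEquiv h.measurePreserving).apply_symm_apply y
  filter_upwards [h.halfLine_ac_weighted_inv
      (Lp.coeFn_compMeasurePreserving (h.flatten x) h.measurePreserving),
    h.halfLine_ac_weighted_inv (smulLpₗᵢ_apply_ae (𝕜 := ℂ) _ _ _ _ x)] with ξ h₁ (h₂ : y ξ = _)
  rw [hcomp] at h₁
  exact h₁.symm.trans h₂

theorem ae_eq_flatten_smul (h : IsTravelTime lam P) (x : L2 lam) :
    ∀ᵐ ξ ∂halfLine, (lam ξ)⁻¹ • (h.flatten x ∘ P) ξ = x ξ := by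
  filter_upwards [h.flatten_apply_ae x, h.ae_ne_zero] with ξ hξ hne
  rw [Function.comp_apply, hξ, Complex.real_smul, Complex.ofReal_inv, inv_mul_cancel_left₀ hne]

theorem intervalIntegrable_and_integral_eq (h : IsTravelTime lam P) (x : L2 lam) {ξ : ℝ}
    (hξ : 0 ≤ ξ) :
    IntervalIntegrable x volume 0 ξ ∧
      ∫ ζ in (0 : ℝ)..ξ, x ζ = ∫ s in (0 : ℝ)..P ξ, h.flatten x s := by
  have hae : (fun ζ => (lam ζ)⁻¹ • (h.flatten x ∘ P) ζ) =ᵐ[volume.restrict (uIoc 0 ξ)] x := by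
    refine ae_restrict_of_ae_restrict_of_subset ?_ (h.ae_eq_flatten_smul x)
    exact fun ζ hζ => (uIoc_of_le hξ ▸ hζ).1
  have hderiv (ζ : ℝ) (hζ : ζ ∈ Ioo (min 0 ξ) (max 0 ξ)) : HasDerivAt P (lam ζ)⁻¹ ζ :=
    h.hasDerivAt (min_eq_left hξ ▸ hζ.1)
  have hnonneg (ζ : ℝ) (hζ : ζ ∈ Ioo (min 0 ξ) (max 0 ξ)) : 0 ≤ (lam ζ)⁻¹ :=
    inv_nonneg.2 (h.pos ζ (min_eq_left hξ ▸ hζ.1.le)).le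
  have hPξ : 0 ≤ P ξ := h.map_zero ▸ P.monotone hξ
  constructor
  · refine IntervalIntegrable.congr_ae ?_ hae
    rw [intervalIntegral.integrable_deriv_smul_comp_iff_of_deriv_nonneg P.continuous.continuousOn
      hderiv hnonneg, h.map_zero]
    exact intervalIntegrable_of_Lp_halfLine _ le_rfl hPξ
  · rw [← intervalIntegral.integral_congr_ae_restrict hae,
      intervalIntegral.integral_deriv_smul_comp_of_deriv_nonneg P.continuous.continuousOn
      hderiv hnonneg, h.map_zero]

/-- The semigroup `T_lam`, obtained from left translation by `flatten`. -/
def semigroup (h : IsTravelTime lam P) : ℝ≥0 → L2 lam →L[ℂ] L2 lam :=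
  conjBy h.flatten (leftShift ℂ 2)

theorem isC0Semigroup_semigroup (h : IsTravelTime lam P) : IsC0Semigroup h.semigroup :=
  (isC0Semigroup_leftShift (p := 2) ENNReal.ofNat_ne_top).conjBy h.flatten

theorem semigroup_apply_ae (h : IsTravelTime lam P) (t : ℝ≥0) {x : L2 lam} {f : ℝ → ℂ}
    (hf : ∀ᵐ ξ ∂halfLine, f ξ = x ξ) :
    ∀ᵐ ξ ∂halfLine, h.semigroup t x ξ =
      ((lam (ξ + displacement lam ξ t) / lam ξ : ℝ) : ℂ) * f (ξ + displacement lam ξ t) := by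
  have hconj : h.flatten (h.semigroup t x) = leftShift ℂ 2 t (h.flatten x) :=
    h.flatten.apply_symm_apply _
  have hx : ∀ᵐ s ∂halfLine, h.flatten x s = lam (P.symm s) * f (P.symm s) := by
    refine h.ae_comp_iff.1 ?_
    filter_upwards [h.flatten_apply_ae x, hf] with ξ h₁ h₂
    rw [h₁, P.symm_apply_apply, h₂]
  filter_upwards [h.flatten_apply_ae (h.semigroup t x),
    h.ae_comp_iff.2 (leftShift_apply_ae t (h.flatten x)),
    h.ae_comp_iff.2 (ae_halfLine_add_right hx t), h.ae_ne_zero,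
    ae_restrict_mem measurableSet_Ioi] with ξ h₁ h₂ h₃ hne (hξ : 0 < ξ)
  rw [h.add_displacement hξ.le t.coe_nonneg, Complex.ofReal_div, div_mul_eq_mul_div,
    eq_div_iff hne, ← h₃, ← h₂, ← hconj, h₁, mul_comm]

theorem isGeneratorOf_semigroup (h : IsTravelTime lam P) :
    IsGeneratorOf (transportOperator lam h.continuousOn h.pos) h.semigroup := by
  intro x z
  calc (x, z) ∈ (transportOperator lam h.continuousOn h.pos).graph
      ↔ ∃ c, ∀ᵐ ξ ∂halfLine, (lam ξ : ℂ) * x ξ = c + ∫ v in (0 : ℝ)..ξ, z v :=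
        mem_graph_transportOperator_iff_integral _ _ fun _ hb =>
          (h.intervalIntegrable_and_integral_eq z hb).1
    _ ↔ ∃ c, ∀ᵐ ξ ∂halfLine, h.flatten x (P ξ) = c + ∫ s in (0 : ℝ)..P ξ, h.flatten z s := by
        refine exists_congr fun c => eventually_congr ?_
        filter_upwards [h.flatten_apply_ae x, ae_restrict_mem measurableSet_Ioi] with ξ h₁ hξ
        rw [h₁, (h.intervalIntegrable_and_integral_eq z (le_of_lt hξ)).2]
    _ ↔ ∃ c, ∀ᵐ s ∂halfLine, h.flatten x s = c + ∫ r in (0 : ℝ)..s, h.flatten z r :=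
        exists_congr fun c => h.ae_comp_iff
          (q := fun s => h.flatten x s = c + ∫ r in (0 : ℝ)..s, h.flatten z r)
    _ ↔ HasOrbitDeriv (leftShift ℂ 2) (h.flatten x) (h.flatten z) :=
        (hasOrbitDeriv_leftShift_iff (p := 2) ENNReal.ofNat_ne_top).symm
    _ ↔ HasOrbitDeriv h.semigroup x z := (hasOrbitDeriv_conjBy_iff h.flatten).symm

end IsTravelTime

end Flatten

end

end WeightedTransport

theorem proposition4p2 (lam : ℝ → ℝ) (hc : ContinuousOn lam (Set.Ici 0))
    (hpos : ∀ ξ : ℝ, 0 ≤ ξ → 0 < lam ξ)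
    (hint : ¬ MeasureTheory.IntegrableOn (fun ξ : ℝ => 1 / lam ξ) (Set.Ioi 0)
      MeasureTheory.volume) :
    Set.BijOn (WeightedTransport.travelTime lam) (Set.Ici 0) (Set.Ici 0) ∧
    ∃ T : ℝ≥0 → WeightedTransport.L2 lam →L[ℂ] WeightedTransport.L2 lam,
      (∀ (t : ℝ≥0) (x : WeightedTransport.L2 lam) (f : ℝ → ℂ),
        (∀ᵐ ξ ∂WeightedTransport.halfLine, f ξ = x ξ) →
        ∀ᵐ ξ ∂WeightedTransport.halfLine, T t x ξ =
          ((lam (ξ + WeightedTransport.displacement lam ξ t) / lam ξ : ℝ) : ℂ) *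
            f (ξ + WeightedTransport.displacement lam ξ t)) ∧
      WeightedTransport.IsC0Semigroup T ∧
      WeightedTransport.IsGeneratorOf (WeightedTransport.transportOperator lam hc hpos) T := by
  obtain ⟨P, h⟩ := WeightedTransport.exists_isTravelTime hc hpos hint
  exact ⟨h.bijOn, h.semigroup, fun t _ _ hf => h.semigroup_apply_ae t hf,
    h.isC0Semigroup_semigroup, h.isGeneratorOf_semigroup⟩
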